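/- All graphs are finite, simple and undirected. A set $S$ of vertices of a graph $G$ is a cutset of $G$ if $G-S$ is disconnected, that is, has at least two components; it is an independent cutset if moreover its vertices are pairwise nonadjacent. {\sc Independent Cutset} is the decision problem whose instance is a connected graph $G$ and whose question is whether $G$ has an independent cutset. For $t\ge 1$, $tK_2$ denotes the disjoint union of $t$ copies of the complete graph $K_2$, and a graph is $tK_2$-free if it does not contain $tK_2$ as an induced subgraph. For every constant integer $t\ge 1$, {\sc Independent Cutset} can be solved in polynomial time on $tK_2$-free graphs; that is, there are an algorithm $P_t$ (a program for a unit-cost random access machine with addition and subtraction) and a polynomial $p_t$ such that, for every connected $tK_2$-free graph $G$ on $n$ vertices, given by its adjacency matrix, $P_t$ halts after at most $p_t(n)$ steps and correctly decides whether $G$ has an independent cutset. -/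

import Mathlib

open scoped SimpleGraph

/-! ### Graphs -/

/-- `S` is a cutset of `G` if `G - S` is disconnected, i.e. two vertices outside `S` lie in
different components of `G - S`. (`G - S` without vertices does not count as disconnected.) -/
def IsCutset {V : Type*} (G : SimpleGraph V) (S : Set V) : Prop :=
  ¬ (G.induce Sᶜ).Preconnected

/-- `G` has a cutset whose vertices are pairwise nonadjacent. -/
def HasIndependentCutset {V : Type*} (G : SimpleGraph V) : Prop :=
  ∃ S : Set V, G.IsIndepSet S ∧ IsCutset G S

/-- The graph `t K₂`: the disjoint union of `t` copies of `K₂`; the `i`-th edge joins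
`(i, false)` and `(i, true)`. -/
def copiesOfK2 (t : ℕ) : SimpleGraph (Fin t × Bool) where
  Adj x y := x.1 = y.1 ∧ x.2 ≠ y.2
  symm := ⟨fun _ _ h => ⟨h.1.symm, h.2.symm⟩⟩
  loopless := ⟨fun _ h => h.2 rfl⟩

/-- `G` is `H`-free: `H` is not an induced subgraph of `G`. -/
def IsFreeOf {V W : Type*} (H : SimpleGraph W) (G : SimpleGraph V) : Prop :=
  ¬ H ⊴ G

/-! ### A random access machine with unit cost

A program is a fixed finite text. It uses registers (named by numbers) and memory banks (named by
numbers, each a sequence of cells that is addressed indirectly through a register); both hold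
natural numbers. The only arithmetic is addition and truncated subtraction, so that numbers have
at most linearly many bits in the running time and unit cost is polynomially equivalent to
Turing machine time. -/

namespace RAM

/-- Programs. -/
inductive Prog : Type
  /-- do nothing -/
  | skip
  /-- `r := c` for a constant `c` -/
  | const (r c : ℕ)
  /-- `r := a` -/
  | copy (r a : ℕ)
  /-- `r := a + b` -/
  | add (r a b : ℕ)
  /-- `r := max (a - b) 0` -/
  | sub (r a b : ℕ)
  /-- `r := bank[a]`, the content of the cell of the bank whose address is in register `a` -/
  | load (r bank a : ℕ)
  /-- `bank[a] := r` -/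
  | store (bank a r : ℕ)
  /-- first `P`, then `Q` -/
  | seq (P Q : Prog)
  /-- `P` if register `r` is nonzero, otherwise `Q` -/
  | branch (r : ℕ) (P Q : Prog)
  /-- repeat `P` as long as register `r` is nonzero -/
  | loop (r : ℕ) (P : Prog)

/-- Contents of the registers and of the memory banks. -/
@[ext]
structure State : Type where
  reg : ℕ → ℕ
  mem : ℕ → ℕ → ℕ

/-- Write `v` into register `r`. -/
def State.setReg (s : State) (r v : ℕ) : State :=
  { s with reg := Function.update s.reg r v }

/-- Write `v` into the cell with address `a` of a bank. -/
def State.setMem (s : State) (bank a v : ℕ) : State :=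
  { s with mem := Function.update s.mem bank (Function.update (s.mem bank) a v) }

/-- `Exec P s s' k`: started in `s`, the program `P` halts in `s'` after exactly `k` steps. Each
elementary instruction and each test of a branch or loop is one step. -/
inductive Exec : Prog → State → State → ℕ → Prop
  | skip (s : State) : Exec .skip s s 1
  | const (s : State) (r c : ℕ) : Exec (.const r c) s (s.setReg r c) 1
  | copy (s : State) (r a : ℕ) : Exec (.copy r a) s (s.setReg r (s.reg a)) 1
  | add (s : State) (r a b : ℕ) : Exec (.add r a b) s (s.setReg r (s.reg a + s.reg b)) 1
  | sub (s : State) (r a b : ℕ) : Exec (.sub r a b) s (s.setReg r (s.reg a - s.reg b)) 1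
  | load (s : State) (r bank a : ℕ) :
      Exec (.load r bank a) s (s.setReg r (s.mem bank (s.reg a))) 1
  | store (s : State) (bank a r : ℕ) :
      Exec (.store bank a r) s (s.setMem bank (s.reg a) (s.reg r)) 1
  | seq {P Q : Prog} {s s₁ s₂ : State} {k l : ℕ} :
      Exec P s s₁ k → Exec Q s₁ s₂ l → Exec (.seq P Q) s s₂ (k + l)
  | branch_true {P Q : Prog} {r : ℕ} {s s₁ : State} {k : ℕ} :
      s.reg r ≠ 0 → Exec P s s₁ k → Exec (.branch r P Q) s s₁ (k + 1)
  | branch_false {P Q : Prog} {r : ℕ} {s s₁ : State} {k : ℕ} :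
      s.reg r = 0 → Exec Q s s₁ k → Exec (.branch r P Q) s s₁ (k + 1)
  | loop_true {P : Prog} {r : ℕ} {s s₁ s₂ : State} {k l : ℕ} :
      s.reg r ≠ 0 → Exec P s s₁ k → Exec (.loop r P) s₁ s₂ l → Exec (.loop r P) s s₂ (k + l + 1)
  | loop_false {P : Prog} {r : ℕ} {s : State} :
      s.reg r = 0 → Exec (.loop r P) s s 1

/-- Programs are deterministic: the final state and the number of steps are determined by the
program and the initial state. -/
theorem Exec.deterministic {P : Prog} {s s₁ s₂ : State} {k l : ℕ}
    (h₁ : Exec P s s₁ k) (h₂ : Exec P s s₂ l) : s₁ = s₂ ∧ k = l := by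
  induction h₁ generalizing s₂ l with
  | seq _ _ ih₁ ih₂ =>
    cases h₂ with
    | seq a b =>
      obtain ⟨rfl, rfl⟩ := ih₁ a
      obtain ⟨rfl, rfl⟩ := ih₂ b
      exact ⟨rfl, rfl⟩
  | branch_true h _ ih =>
    cases h₂ with
    | branch_true _ a => obtain ⟨rfl, rfl⟩ := ih a; exact ⟨rfl, rfl⟩
    | branch_false h' _ => exact absurd h' h
  | branch_false h _ ih =>
    cases h₂ with
    | branch_true h' _ => exact absurd h h'
    | branch_false _ a => obtain ⟨rfl, rfl⟩ := ih a; exact ⟨rfl, rfl⟩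
  | loop_true h _ _ ih₁ ih₂ =>
    cases h₂ with
    | loop_true _ a b =>
      obtain ⟨rfl, rfl⟩ := ih₁ a
      obtain ⟨rfl, rfl⟩ := ih₂ b
      exact ⟨rfl, rfl⟩
    | loop_false h' => exact absurd h' h
  | loop_false h =>
    cases h₂ with
    | loop_true h' _ _ => exact absurd h h'
    | loop_false _ => exact ⟨rfl, rfl⟩
  | _ => cases h₂; exact ⟨rfl, rfl⟩

open Classical in
/-- The input of a graph `G` with vertices `0, …, n - 1`: register `0` holds `n`, bank `0` holds
the adjacency matrix of `G` row by row, and everything else is `0`. -/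
noncomputable def input {n : ℕ} (G : SimpleGraph (Fin n)) : State where
  reg r := if r = 0 then n else 0
  mem bank a :=
    if bank = 0 ∧ ∃ i j : Fin n, a = (i : ℕ) * n + (j : ℕ) ∧ G.Adj i j then 1 else 0

/-- The decision problem "does `G` satisfy `Q`?", for input graphs `G` in the class `C`, can be
solved in polynomial time: one program answers it (register `0` finally holds `1` for yes and `0`
for no) within a number of steps that is bounded by a polynomial in the number of vertices. -/
def SolvableInPolyTime (C Q : ∀ n : ℕ, SimpleGraph (Fin n) → Prop) : Prop :=
  ∃ (P : Prog) (p : Polynomial ℕ), ∀ (n : ℕ) (G : SimpleGraph (Fin n)), C n G →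
    ∃ (s : State) (k : ℕ), Exec P (input G) s k ∧ k ≤ p.eval n ∧
      (Q n G → s.reg 0 = 1) ∧ (¬ Q n G → s.reg 0 = 0)

end RAM

/-!
If a connected graph has an independent cutset, then some *maximal* independent set is a cutset:
enlarging an independent cutset to a maximal independent set swallows no component, because a
swallowed component would be a single vertex without neighbours
(`SimpleGraph.Connected.exists_dominating_cutset`). A `t K₂`-free graph has only polynomially many
maximal independent sets, and they can be listed without storing them. Order the vertices, and let
`I` be a maximal independent set. It is not quite the set that the greedy procedure finds when it
goes through the vertices in descending order: a vertex `u ∉ I` may have all its neighbours in `I`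
below it. Among these `u`, take one whose largest neighbour `v ∈ I` is smallest, record the edge
`u v`, forbid to the procedure the vertices above `v` that are adjacent to `u` or `v`, and repeat
with the `u` that are not yet forbidden. The recorded edges form an induced matching, so that there
are fewer than `t` of them, and in the end the greedy procedure with these vertices forbidden
finds exactly `I` (`exists_isGreedy_or_isMatchingChain`). As the result of the procedure is
independent for every choice of the pairs, `G` has an independent cutset if and only if for some
`t` pairs of vertices the greedy set is a cutset
(`SimpleGraph.Connected.hasIndependentCutset_iff_exists_isGreedy`).

The algorithm runs through all `t`-tuples of pairs, computes the greedy set `I`, and searches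
`G - I` from every vertex outside `I`. It is written in a small language of statements `RAM.Stmt`
over formulas `RAM.Fml`, all of whose loops and quantifiers range over the numbers below `n`.
Every statement is translated into a program for the random access machine that computes its
denotation and whose number of steps is bounded by a polynomial read off from the syntax
(`RAM.Stmt.run_compile`). Thus only the denotation has to be analysed
(`RAM.accumulates_testStmt`, `RAM.Accumulates.forPairs`).
-/

/-! ### Maximal independent sets and cutsets -/

/-- An independent cutset of a connected graph remains a cutset when it is enlarged to a maximal
independent set `I`: no component of the rest is swallowed, since a vertex in `I` has a
neighbour, which lies outside `I`. -/
theorem SimpleGraph.Connected.exists_dominating_cutset {V : Type*} [Finite V] {G : SimpleGraph V}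
    (hG : G.Connected) (h : HasIndependentCutset G) :
    ∃ I : Set V, G.IsIndepSet I ∧ (∀ x ∉ I, ∃ y ∈ I, G.Adj x y) ∧ IsCutset G I := by
  obtain ⟨S, hS, hcut⟩ := h
  obtain ⟨I, hSI, hI⟩ := (Set.toFinite {I : Set V | G.IsIndepSet I}).exists_le_maximal hS
  have hind : G.IsIndepSet I := hI.prop
  refine ⟨I, hind, fun x hx => ?_, ?_⟩
  · by_contra! hno
    refine hx (hI.le_of_ge (y := insert x I) ?_ (Set.subset_insert _ _) (Set.mem_insert _ _))
    exact hind.insert fun y hy _ => ⟨hno y hy, fun h => hno y hy h.symm⟩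
  · intro hpre
    apply hcut
    have hnt : ∀ a b : V, a ≠ b → ∃ c, G.Adj a c := by
      intro a b hab
      have : Nontrivial V := ⟨a, b, hab⟩
      exact hG.preconnected.exists_adj_of_nontrivial a
    -- every vertex outside `S` reaches a vertex outside `I` without meeting `S`
    have key : ∀ a : (Sᶜ : Set V), ∀ b : V, a.1 ≠ b →
        ∃ c : (Sᶜ : Set V), c.1 ∉ I ∧ (G.induce Sᶜ).Reachable a c := by
      rintro ⟨a, ha⟩ b hab
      by_cases haI : a ∈ I
      · obtain ⟨c, hc⟩ := hnt a b hab
        have hcI : c ∉ I := fun h => hind haI h hc.ne hc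
        refine ⟨⟨c, fun h => hcI (hSI h)⟩, hcI, SimpleGraph.Adj.reachable ?_⟩
        exact hc
      · exact ⟨⟨a, ha⟩, haI, .refl _⟩
    intro a b
    by_cases hab : a = b
    · rw [hab]
    have hab' : a.1 ≠ b.1 := fun h => hab (Subtype.ext h)
    obtain ⟨a', ha', hra⟩ := key a b.1 hab'
    obtain ⟨b', hb', hrb⟩ := key b a.1 hab'.symm
    have hr := hpre ⟨a'.1, ha'⟩ ⟨b'.1, hb'⟩
    have hle : (Iᶜ : Set V) ⊆ Sᶜ := Set.compl_subset_compl.2 hSI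
    have := hr.map (SimpleGraph.induceHomOfLE G hle).toHom
    exact (hra.trans this).trans hrb.symm

/-! ### Greedy independent sets -/

section Greedy

variable {V : Type*} [LinearOrder V]

/-- `x` is forbidden by the pairs `(u i, v i)`, `i < k`: it comes after some `v i` and is
adjacent to that `v i` or to `u i`. -/
def Forbidden (A : V → V → Prop) (u v : ℕ → V) (k : ℕ) (x : V) : Prop :=
  ∃ i < k, v i < x ∧ (A x (v i) ∨ A x (u i))

/-- `I` is the set that is obtained by going through the vertices in descending order and taking
each that is not in `F` and has no neighbour among those taken already. -/
def IsGreedy (A : V → V → Prop) (F : V → Prop) (I : V → Prop) : Prop :=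
  ∀ x, I x ↔ ¬ F x ∧ ¬ ∃ y, x < y ∧ I y ∧ A x y

theorem IsGreedy.unique [WellFoundedGT V] {A : V → V → Prop} {F I J : V → Prop}
    (hI : IsGreedy A F I) (hJ : IsGreedy A F J) (x : V) : I x ↔ J x := by
  induction x using WellFoundedGT.induction with
  | ind x ih =>
    rw [hI x, hJ x]
    refine and_congr_right fun _ => not_congr (exists_congr fun y => ?_)
    exact and_congr_right fun hy => by rw [ih y hy]

theorem IsGreedy.isIndepSet {G : SimpleGraph V} {F I : V → Prop} (hI : IsGreedy G.Adj F I) :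
    G.IsIndepSet {x | I x} := by
  intro x hx y hy hxy hadj
  rcases lt_or_gt_of_ne hxy with h | h
  · exact ((hI x).1 hx).2 ⟨y, h, hy, hadj⟩
  · exact ((hI y).1 hy).2 ⟨x, h, hx, hadj.symm⟩

/-- A sequence of `k` edges `u i v i`, where `v i` is the largest neighbour of `u i` in `I`, the
`v i` increase, and `u i` is not adjacent to the earlier edges; if `I` is independent, they form an
induced matching. By the last condition, the sequence can be continued with any vertex `x` that is
not forbidden and has all its neighbours in `I` below it: its largest neighbour in `I` is at least
as large as the `v i`. -/
structure IsMatchingChain (G : SimpleGraph V) (I : Set V) (u v : ℕ → V) (k : ℕ) : Prop where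
  mem : ∀ i < k, v i ∈ I
  adj : ∀ i < k, G.Adj (u i) (v i)
  le : ∀ i < k, ∀ w ∈ I, G.Adj (u i) w → w ≤ v i
  lt : ∀ i < k, ∀ j < i, v j < v i
  not_adj : ∀ i < k, ∀ j < i, ¬ G.Adj (u i) (v j) ∧ ¬ G.Adj (u i) (u j)
  min : ∀ x w, w ∈ I → G.Adj x w → w < x → (∀ y ∈ I, G.Adj x y → y ≤ w) →
    ¬ Forbidden G.Adj u v k x → ∀ i < k, v i ≤ w

theorem IsMatchingChain.not_isFreeOf {G : SimpleGraph V} {I : Set V} {u v : ℕ → V} {k : ℕ}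
    (h : IsMatchingChain G I u v k) (hI : G.IsIndepSet I) : ¬ IsFreeOf (copiesOfK2 k) G := by
  have hvv : ∀ i < k, ∀ j < k, ¬ G.Adj (v i) (v j) := fun i hi j hj hadj =>
    hI (h.mem i hi) (h.mem j hj) hadj.ne hadj
  have huu : ∀ i < k, ∀ j < k, ¬ G.Adj (u i) (u j) := by
    intro i hi j hj hadj
    rcases lt_trichotomy i j with hij | rfl | hij
    · exact (h.not_adj j hj i hij).2 hadj.symm
    · exact hadj.ne rfl
    · exact (h.not_adj i hi j hij).2 hadj
  have huv : ∀ i < k, ∀ j < k, G.Adj (u i) (v j) ↔ i = j := by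
    intro i hi j hj
    refine ⟨fun hadj => ?_, fun hij => hij ▸ h.adj i hi⟩
    rcases lt_trichotomy i j with hij | hij | hij
    · exact absurd (h.le i hi _ (h.mem j hj) hadj) (not_le.2 (h.lt j hj i hij))
    · exact hij
    · exact absurd hadj (h.not_adj i hi j hij).1
  let f : Fin k × Bool → V := fun p => if p.2 then v p.1 else u p.1
  have hf : ∀ p q, G.Adj (f p) (f q) ↔ (copiesOfK2 k).Adj p q := by
    rintro ⟨i, bi⟩ ⟨j, bj⟩
    have h1 := huv i i.2 j j.2
    have h2 := huv j j.2 i i.2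
    cases bi <;> cases bj
    · simp [f, copiesOfK2, huu i i.2 j j.2]
    · simp [f, copiesOfK2, h1, Fin.ext_iff]
    · rw [G.adj_comm]
      simpa [f, copiesOfK2, h2, Fin.ext_iff] using eq_comm
    · simp [f, copiesOfK2, hvv i i.2 j j.2]
  -- vertices of `t K₂` are determined by their neighbours, so `f` is injective
  have hinj : Function.Injective f := by
    rintro ⟨i, bi⟩ ⟨j, bj⟩ hpq
    have h1 : (copiesOfK2 k).Adj (i, bi) (i, !bi) := ⟨rfl, by simp⟩
    rw [← hf, hpq, hf] at h1
    obtain ⟨h2, h3⟩ := h1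
    simp only at h2 h3
    subst h2
    simpa using h3.symm
  exact fun hfree => hfree ⟨⟨⟨f, hinj⟩, fun {p q} => hf p q⟩⟩

theorem Forbidden.congr {A : V → V → Prop} {u v u' v' : ℕ → V} {k : ℕ} {x : V}
    (hu : ∀ i < k, u i = u' i) (hv : ∀ i < k, v i = v' i) :
    Forbidden A u v k x ↔ Forbidden A u' v' k x := by
  refine exists_congr fun i => and_congr_right fun hi => ?_
  rw [hu i hi, hv i hi]

theorem forbidden_succ {A : V → V → Prop} {u v : ℕ → V} {k : ℕ} {x : V} :
    Forbidden A u v (k + 1) x ↔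
      Forbidden A u v k x ∨ (v k < x ∧ (A x (v k) ∨ A x (u k))) := by
  simp only [Forbidden, Nat.lt_succ_iff_lt_or_eq, or_and_right, exists_or, exists_eq_left]

/-- A maximal independent set is greedy with respect to some sequence of pairs as soon as this
sequence cannot be extended to a longer induced matching: a vertex outside `I` without larger
neighbour in `I` is forbidden, or else it provides the next pair. -/
theorem exists_isGreedy_or_isMatchingChain [Finite V] [OrderTop V] {G : SimpleGraph V} {I : Set V}
    (hI : G.IsIndepSet I) (hdom : ∀ x ∉ I, ∃ y ∈ I, G.Adj x y) (k : ℕ) :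
    (∃ u v : ℕ → V, IsGreedy G.Adj (Forbidden G.Adj u v k) (· ∈ I)) ∨
      ∃ u v : ℕ → V, IsMatchingChain G I u v k := by
  -- sequences may be padded with `⊤`, after which no vertex comes
  have pad : ∀ (k : ℕ) (u v : ℕ → V), IsGreedy G.Adj (Forbidden G.Adj u v k) (· ∈ I) →
      ∃ u v : ℕ → V, IsGreedy G.Adj (Forbidden G.Adj u v (k + 1)) (· ∈ I) := by
    intro k u v h
    refine ⟨u, Function.update v k ⊤, fun x => (h x).trans ?_⟩
    refine and_congr_left fun _ => not_congr ?_
    rw [forbidden_succ, Forbidden.congr (u' := u) (v' := Function.update v k ⊤)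
      (fun _ _ => rfl) (fun i hi => by simp [hi.ne])]
    simp
  induction k with
  | zero =>
    refine .inr ⟨fun _ => ⊤, fun _ => ⊤, ?_⟩
    constructor <;> simp
  | succ k ih =>
    rcases ih with ⟨u, v, h⟩ | ⟨u, v, h⟩
    · exact .inl (pad k u v h)
    -- the vertices `w` that may serve as `v k`
    let C : Set V := {w | w ∈ I ∧ ∃ x, G.Adj x w ∧ w < x ∧ (∀ y ∈ I, G.Adj x y → y ≤ w) ∧
      ¬ Forbidden G.Adj u v k x}
    rcases C.eq_empty_or_nonempty with hC | hC
    · refine .inl (pad k u v fun x => ⟨fun hx => ⟨?_, ?_⟩, fun hx => ?_⟩)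
      · rintro ⟨i, hi, hlt, hadj | hadj⟩
        · exact hI hx (h.mem i hi) hadj.ne hadj
        · exact absurd (h.le i hi x hx hadj.symm) (not_le.2 hlt)
      · rintro ⟨y, -, hy, hadj⟩
        exact hI hx hy hadj.ne hadj
      · by_contra hxI
        obtain ⟨w, hw, hmax⟩ := (Set.toFinite {y | y ∈ I ∧ G.Adj x y}).exists_maximalFor id _
          (hdom x hxI)
        have hle : ∀ y ∈ I, G.Adj x y → y ≤ w := fun y hy hadj =>
          (le_total y w).elim id fun hwy => hmax ⟨hy, hadj⟩ hwy
        have hwx : w < x := lt_of_not_ge fun hge =>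
          hx.2 ⟨w, lt_of_le_of_ne hge hw.2.ne, hw⟩
        exact (Set.eq_empty_iff_forall_notMem.1 hC) w ⟨hw.1, x, hw.2, hwx, hle, hx.1⟩
    · obtain ⟨w, ⟨hwI, x, hadj, hwx, hle, hF⟩, hmin⟩ := (Set.toFinite C).exists_minimalFor id C hC
      have hvw : ∀ i < k, v i ≤ w := h.min x w hwI hadj hwx hle hF
      have hxu : ∀ i < k, ¬ G.Adj x (v i) ∧ ¬ G.Adj x (u i) := fun i hi => by
        have := fun h' => hF ⟨i, hi, (hvw i hi).trans_lt hwx, h'⟩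
        tauto
      have hu' : ∀ i, i < k → Function.update u k x i = u i := fun i hi => by simp [hi.ne]
      have hv' : ∀ i, i < k → Function.update v k w i = v i := fun i hi => by simp [hi.ne]
      refine .inr ⟨Function.update u k x, Function.update v k w, ?_⟩
      constructor
      · intro i hi
        rcases Nat.lt_succ_iff_lt_or_eq.1 hi with hi | rfl
        · rw [hv' i hi]; exact h.mem i hi
        · simpa using hwI
      · intro i hi
        rcases Nat.lt_succ_iff_lt_or_eq.1 hi with hi | rfl
        · rw [hu' i hi, hv' i hi]; exact h.adj i hi
        · simpa using hadj
      · intro i hi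
        rcases Nat.lt_succ_iff_lt_or_eq.1 hi with hi | rfl
        · rw [hu' i hi, hv' i hi]; exact h.le i hi
        · simpa using hle
      · intro i hi j hj
        rcases Nat.lt_succ_iff_lt_or_eq.1 hi with hi | rfl
        · rw [hv' i hi, hv' j (hj.trans hi)]; exact h.lt i hi j hj
        · rw [hv' j hj, Function.update_self]
          refine lt_of_le_of_ne (hvw j hj) fun h' => (hxu j hj).1 (h' ▸ hadj)
      · intro i hi j hj
        rcases Nat.lt_succ_iff_lt_or_eq.1 hi with hi | rfl
        · rw [hu' i hi, hu' j (hj.trans hi), hv' j (hj.trans hi)]; exact h.not_adj i hi j hj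
        · rw [hu' j hj, hv' j hj, Function.update_self]
          exact hxu j hj
      · intro y z hz hyz hzy hmax hFy i hi
        rw [forbidden_succ, Forbidden.congr hu' hv', not_or] at hFy
        rcases Nat.lt_succ_iff_lt_or_eq.1 hi with hi | rfl
        · rw [hv' i hi]; exact h.min y z hz hyz hzy hmax hFy.1 i hi
        · rw [Function.update_self]
          exact (le_total w z).elim id fun hzw => hmin ⟨hz, y, hyz, hzy, hmax, hFy.1⟩ hzw

/-- In a connected `t K₂`-free graph, `t` pairs of vertices suffice to find an independent cutset
among the greedy independent sets. -/
theorem SimpleGraph.Connected.hasIndependentCutset_iff_exists_isGreedy [Finite V] [OrderTop V]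
    {G : SimpleGraph V} {t : ℕ} (hG : G.Connected) (hfree : IsFreeOf (copiesOfK2 t) G) :
    HasIndependentCutset G ↔ ∃ (u v : ℕ → V) (I : V → Prop),
      IsGreedy G.Adj (Forbidden G.Adj u v t) I ∧ IsCutset G {x | I x} := by
  constructor
  · intro h
    obtain ⟨I, hI, hdom, hcut⟩ := hG.exists_dominating_cutset h
    rcases exists_isGreedy_or_isMatchingChain hI hdom t with ⟨u, v, hg⟩ | ⟨u, v, hc⟩
    · exact ⟨u, v, (· ∈ I), hg, hcut⟩
    · exact absurd hfree (hc.not_isFreeOf hI)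
  · rintro ⟨u, v, I, hI, hcut⟩
    exact ⟨_, hI.isIndepSet, hcut⟩

end Greedy

namespace RAM

/-! ### Bounded runs of programs -/

/-- Started in `s`, the program `P` halts within `T` steps in a state that satisfies `Q`. -/
def Run (P : Prog) (s : State) (T : ℕ) (Q : State → Prop) : Prop :=
  ∃ s' k, Exec P s s' k ∧ k ≤ T ∧ Q s'

theorem Run.mono {P : Prog} {s : State} {T T' : ℕ} {Q Q' : State → Prop}
    (h : Run P s T Q) (hT : T ≤ T') (hQ : ∀ s', Q s' → Q' s') : Run P s T' Q' := by
  obtain ⟨s', k, he, hk, hq⟩ := h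
  exact ⟨s', k, he, hk.trans hT, hQ _ hq⟩

theorem Run.seq {P Q : Prog} {s : State} {T₁ T₂ : ℕ} {R : State → Prop}
    (h : Run P s T₁ fun s' => Run Q s' T₂ R) : Run (.seq P Q) s (T₁ + T₂) R := by
  obtain ⟨s₁, k, he, hk, s₂, l, he', hl, hR⟩ := h
  exact ⟨s₂, k + l, .seq he he', by lia, hR⟩

theorem Run.skip {s : State} {Q : State → Prop} (h : Q s) : Run .skip s 1 Q :=
  ⟨_, 1, .skip s, le_rfl, h⟩

theorem Run.const {s : State} {r c : ℕ} {Q : State → Prop} (h : Q (s.setReg r c)) :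
    Run (.const r c) s 1 Q :=
  ⟨_, 1, .const s r c, le_rfl, h⟩

theorem Run.copy {s : State} {r a : ℕ} {Q : State → Prop} (h : Q (s.setReg r (s.reg a))) :
    Run (.copy r a) s 1 Q :=
  ⟨_, 1, .copy s r a, le_rfl, h⟩

theorem Run.add {s : State} {r a b : ℕ} {Q : State → Prop}
    (h : Q (s.setReg r (s.reg a + s.reg b))) : Run (.add r a b) s 1 Q :=
  ⟨_, 1, .add s r a b, le_rfl, h⟩

theorem Run.sub {s : State} {r a b : ℕ} {Q : State → Prop}
    (h : Q (s.setReg r (s.reg a - s.reg b))) : Run (.sub r a b) s 1 Q :=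
  ⟨_, 1, .sub s r a b, le_rfl, h⟩

theorem Run.load {s : State} {r b a : ℕ} {Q : State → Prop}
    (h : Q (s.setReg r (s.mem b (s.reg a)))) : Run (.load r b a) s 1 Q :=
  ⟨_, 1, .load s r b a, le_rfl, h⟩

theorem Run.store {s : State} {b a r : ℕ} {Q : State → Prop}
    (h : Q (s.setMem b (s.reg a) (s.reg r))) : Run (.store b a r) s 1 Q :=
  ⟨_, 1, .store s b a r, le_rfl, h⟩

theorem Run.branch {P₁ P₂ : Prog} {r : ℕ} {s : State} {T : ℕ} {Q : State → Prop}
    (h₁ : s.reg r ≠ 0 → Run P₁ s T Q) (h₂ : s.reg r = 0 → Run P₂ s T Q) :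
    Run (.branch r P₁ P₂) s (T + 1) Q := by
  by_cases h : s.reg r = 0
  · obtain ⟨s', k, he, hk, hq⟩ := h₂ h
    exact ⟨s', k + 1, .branch_false h he, by lia, hq⟩
  · obtain ⟨s', k, he, hk, hq⟩ := h₁ h
    exact ⟨s', k + 1, .branch_true h he, by lia, hq⟩

@[simp] theorem State.reg_setReg (s : State) (r v r' : ℕ) :
    (s.setReg r v).reg r' = if r' = r then v else s.reg r' := by
  simp [State.setReg, Function.update_apply]

@[simp] theorem State.mem_setReg (s : State) (r v : ℕ) : (s.setReg r v).mem = s.mem := rfl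

@[simp] theorem State.reg_setMem (s : State) (b a v : ℕ) : (s.setMem b a v).reg = s.reg := rfl

@[simp] theorem State.mem_setMem (s : State) (b a v : ℕ) :
    (s.setMem b a v).mem = Function.update s.mem b (Function.update (s.mem b) a v) := rfl

/-- Run `B` for all values of register `x` below its present one, in descending order; register
`t` is overwritten with the constant `1`. -/
def countdown (x t : ℕ) (B : Prog) : Prog :=
  .loop x (.seq (.const t 1) (.seq (.sub x x t) B))

/-- The invariant `Inv j` holds when the values `≥ j` have been dealt with. -/
theorem Run.countdown {x t : ℕ} {B : Prog} {T : ℕ} (hxt : x ≠ t) (Inv : ℕ → State → Prop)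
    (hx : ∀ j s, Inv j s → s.reg x = j) (N : ℕ)
    (hB : ∀ j < N, ∀ s, Inv (j + 1) s → Run B ((s.setReg t 1).setReg x j) T (Inv j)) :
    ∀ s, Inv N s → Run (countdown x t B) s (N * (T + 3) + 1) (Inv 0) := by
  induction N with
  | zero => exact fun s hs => ⟨s, 1, .loop_false (hx _ _ hs), by lia, hs⟩
  | succ N ih =>
    intro s hs
    obtain ⟨s₁, k, he, hk, h₁⟩ := hB N (by lia) s hs
    obtain ⟨s₂, l, he', hl, h₂⟩ := ih (fun j hj => hB j (by lia)) s₁ h₁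
    have hxs := hx _ _ hs
    have hsub : Exec (.sub x x t) (s.setReg t 1) ((s.setReg t 1).setReg x N) 1 := by
      have := Exec.sub (s.setReg t 1) x x t
      simpa [hxt, hxs] using this
    refine ⟨s₂, _, .loop_true (by lia) (.seq (.const _ _ _) (.seq hsub he)) he', ?_, h₂⟩
    rw [Nat.succ_mul]
    lia

/-! ### Formulas with bounded quantifiers and their evaluation by programs

Variables are named by numbers and stand for natural numbers. Variable `x` lives in register
`2 * x + 2`, the odd registers hold intermediate results, and register `0` holds the bound `n` of
all quantifiers and loops. -/

/-- The register of variable `x`. -/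
abbrev varReg (x : ℕ) : ℕ := 2 * x + 2

/-- The register of the `d`-th intermediate result. -/
abbrev tmpReg (d : ℕ) : ℕ := 2 * d + 1

/-- The values of the variables in a state. -/
def State.env (s : State) (x : ℕ) : ℕ := s.reg (varReg x)

/-- First-order formulas over the memory, with quantifiers bounded by `n`. -/
inductive Fml : Type
  /-- `x < y` -/
  | lt (x y : ℕ)
  /-- the cell of the bank with address `x` is nonzero -/
  | bit (b x : ℕ)
  /-- the entry of the matrix in bank `0` at row `x` and column `y` is nonzero -/
  | adj (x y : ℕ)
  /-- negation -/
  | neg (φ : Fml)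
  /-- conjunction -/
  | conj (φ ψ : Fml)
  /-- `φ` holds for some value `x < n` -/
  | ex (x : ℕ) (φ : Fml)

/-- Disjunction. -/
def Fml.disj (φ ψ : Fml) : Fml := .neg (.conj (.neg φ) (.neg ψ))

/-- Truth of a formula for a given memory and given values of the variables. -/
def Fml.Holds (n : ℕ) (m : ℕ → ℕ → ℕ) : Fml → (ℕ → ℕ) → Prop
  | .lt x y, ρ => ρ x < ρ y
  | .bit b x, ρ => m b (ρ x) ≠ 0
  | .adj x y, ρ => m 0 (ρ x * n + ρ y) ≠ 0
  | .neg φ, ρ => ¬ φ.Holds n m ρ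
  | .conj φ ψ, ρ => φ.Holds n m ρ ∧ ψ.Holds n m ρ
  | .ex x φ, ρ => ∃ j < n, φ.Holds n m (Function.update ρ x j)

theorem Fml.holds_disj {n : ℕ} {m : ℕ → ℕ → ℕ} {φ ψ : Fml} {ρ : ℕ → ℕ} :
    (φ.disj ψ).Holds n m ρ ↔ φ.Holds n m ρ ∨ ψ.Holds n m ρ := by
  simp only [Fml.disj, Fml.Holds]; tauto

/-- A program that evaluates a formula, with the result (nonzero for true) in temporary register
`d`. It restores the variables and does not touch the temporary registers below `d`. -/
def Fml.compile : Fml → ℕ → Prog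
  | .lt x y, d => .sub (tmpReg d) (varReg y) (varReg x)
  | .bit b x, d => .load (tmpReg d) b (varReg x)
  | .adj x y, d =>
    .seq (.const (tmpReg d) 0) <| .seq (.copy (tmpReg (d + 1)) (varReg x)) <|
    .seq (countdown (tmpReg (d + 1)) (tmpReg (d + 2)) (.add (tmpReg d) (tmpReg d) 0)) <|
    .seq (.add (tmpReg d) (tmpReg d) (varReg y)) (.load (tmpReg d) 0 (tmpReg d))
  | .neg φ, d =>
    .seq (φ.compile d) (.branch (tmpReg d) (.const (tmpReg d) 0) (.const (tmpReg d) 1))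
  | .conj φ ψ, d => .seq (φ.compile d) (.branch (tmpReg d) (ψ.compile d) .skip)
  | .ex x φ, d =>
    .seq (.const (tmpReg d) 0) <| .seq (.copy (tmpReg (d + 1)) (varReg x)) <|
    .seq (.copy (varReg x) 0) <|
    .seq (countdown (varReg x) (tmpReg (d + 2))
      (.seq (φ.compile (d + 2)) (.branch (tmpReg (d + 2)) (.const (tmpReg d) 1) .skip))) <|
    .copy (varReg x) (tmpReg (d + 1))

/-- A bound on the running time of `Fml.compile`, as a polynomial in `n`. -/
noncomputable def Fml.cost : Fml → Polynomial ℕ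
  | .lt _ _ => 1
  | .bit _ _ => 1
  | .adj _ _ => 4 * .X + 5
  | .neg φ => φ.cost + 2
  | .conj φ ψ => φ.cost + ψ.cost + 2
  | .ex _ φ => .X * (φ.cost + 5) + 5

/-- `s'` has the same memory as `s`, and the same registers except for the temporary registers
from `d` on. -/
def SameUpTo (d : ℕ) (s s' : State) : Prop :=
  s'.mem = s.mem ∧ ∀ r, r % 2 = 0 ∨ r < tmpReg d → s'.reg r = s.reg r

theorem SameUpTo.env {d : ℕ} {s s' : State} (h : SameUpTo d s s') : s'.env = s.env := by
  funext x
  exact h.2 _ (by simp only [varReg]; lia)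

theorem Fml.run_compile (φ : Fml) : ∀ (d n : ℕ) (s : State), s.reg 0 = n → (∀ x, s.env x ≤ n) →
    Run (φ.compile d) s (φ.cost.eval n) fun s' =>
      SameUpTo d s s' ∧ (s'.reg (tmpReg d) ≠ 0 ↔ φ.Holds n s.mem s.env) := by
  induction φ with
  | lt x y =>
    intro d n s hn hs
    refine Run.mono (T := 1) (Run.sub ?_) (by simp [Fml.cost]) fun _ h => h
    refine ⟨⟨rfl, fun r hr => ?_⟩, ?_⟩
    · simp only [State.reg_setReg]; rw [if_neg]; simp only [tmpReg] at *; lia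
    · simp [Fml.Holds, State.env, Nat.sub_eq_zero_iff_le]
  | bit b x =>
    intro d n s hn hs
    refine Run.mono (T := 1) (Run.load ?_) (by simp [Fml.cost]) fun _ h => h
    refine ⟨⟨rfl, fun r hr => ?_⟩, ?_⟩
    · simp only [State.reg_setReg]; rw [if_neg]; simp only [tmpReg] at *; lia
    · simp [Fml.Holds, State.env]
  | adj x y =>
    intro d n s hn hs
    have hx : s.reg (varReg x) ≤ n := hs x
    -- the temporary register `d` counts up to `x * n` while `d + 1` counts down from `x`
    let Inv (j : ℕ) (s' : State) : Prop := SameUpTo d s s' ∧ s'.reg (tmpReg (d + 1)) = j ∧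
      j ≤ s.reg (varReg x) ∧ s'.reg (tmpReg d) = (s.reg (varReg x) - j) * n
    have hloop := Run.countdown (x := tmpReg (d + 1)) (t := tmpReg (d + 2))
      (B := .add (tmpReg d) (tmpReg d) 0) (T := 1) (by simp) Inv (fun _ _ h => h.2.1)
      (s.reg (varReg x)) (by
        rintro j hj s' ⟨⟨hm, hr⟩, h₁, h₂, h₃⟩
        refine Run.add ⟨⟨by simpa using hm, fun r hr' => ?_⟩, ?_, by lia, ?_⟩
        · rw [← hr r hr']
          simp only [State.reg_setReg, tmpReg] at *
          grind
        · simp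
        · have h0 := hr 0 (by simp)
          have h4 : s.reg (varReg x) - j = s.reg (varReg x) - (j + 1) + 1 := by lia
          have h5 : tmpReg d ≠ tmpReg (d + 1) := by simp
          have h6 : tmpReg d ≠ tmpReg (d + 2) := by simp
          have h7 : 0 ≠ tmpReg (d + 1) := by simp
          have h8 : 0 ≠ tmpReg (d + 2) := by simp
          simp only [State.reg_setReg, h5, h6, h7, h8, if_false, if_true, h₃, h0, hn, h4,
            Nat.succ_mul])
    refine (Run.seq (Run.const (Run.seq (Run.copy (Run.seq ((hloop _ ?_).mono le_rfl ?_)))))).mono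
      (T := 1 + (1 + ((s.reg (varReg x) * (1 + 3) + 1) + (1 + 1)))) ?_ fun _ h => h
    · refine ⟨⟨rfl, fun r hr => ?_⟩, ?_, le_rfl, ?_⟩
      · simp only [State.reg_setReg, tmpReg] at *; grind
      · have : varReg x ≠ tmpReg d := by simp only [varReg, tmpReg]; lia
        simp [this]
      · simp
    · rintro s' ⟨⟨hm, hr⟩, h₁, h₂, h₃⟩
      refine Run.seq (Run.add (Run.load ⟨⟨by simpa using hm, fun r hr' => ?_⟩, ?_⟩))
      · rw [← hr r hr']
        simp only [State.reg_setReg, tmpReg] at *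
        grind
      · have := hr (varReg y) (by simp only [varReg]; lia)
        simp [Fml.Holds, State.env, h₃, hm, this]
    · simp [Fml.cost]; lia
  | neg φ ih =>
    intro d n s hn hs
    refine (Run.seq ((ih d n s hn hs).mono le_rfl ?_)).mono
      (T := φ.cost.eval n + (1 + 1)) (by simp [Fml.cost]) fun _ h => h
    rintro s' ⟨⟨hm, hr⟩, h⟩
    refine Run.branch (fun h0 => Run.const ⟨⟨by simpa using hm, fun r hr' => ?_⟩, ?_⟩)
      (fun h0 => Run.const ⟨⟨by simpa using hm, fun r hr' => ?_⟩, ?_⟩)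
    · rw [← hr r hr']; simp only [State.reg_setReg, tmpReg] at *; grind
    · simpa [Fml.Holds] using h.1 h0
    · rw [← hr r hr']; simp only [State.reg_setReg, tmpReg] at *; grind
    · simpa [Fml.Holds] using fun h' => h.2 h' h0
  | conj φ ψ ihφ ihψ =>
    intro d n s hn hs
    refine (Run.seq ((ihφ d n s hn hs).mono le_rfl ?_)).mono
      (T := φ.cost.eval n + (ψ.cost.eval n + 1 + 1)) (by simp [Fml.cost]; lia) fun _ h => h
    rintro s' ⟨hsame, h⟩
    refine Run.branch (fun h0 => (ihψ d n s' ?_ ?_).mono (by lia) ?_)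
      (fun h0 => (Run.skip ?_).mono (by lia) fun _ h => h)
    · rw [hsame.2 0 (by simp), hn]
    · rwa [hsame.env]
    · rintro s'' ⟨hsame', h'⟩
      rw [hsame.env, hsame.1] at h'
      refine ⟨⟨hsame'.1.trans hsame.1, fun r hr => (hsame'.2 r hr).trans (hsame.2 r hr)⟩, ?_⟩
      simp only [Fml.Holds, h', h.1 h0, true_and]
    · exact ⟨hsame, by simp only [Fml.Holds]; tauto⟩
  | ex x φ ih =>
    intro d n s hn hs
    -- temporary register `d` tells whether a witness `≥ j` has been found; `d + 1` keeps the old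
    -- value of variable `x`
    let Inv (j : ℕ) (s' : State) : Prop := s'.mem = s.mem ∧ s'.reg (varReg x) = j ∧
      s'.reg (tmpReg (d + 1)) = s.reg (varReg x) ∧
      (∀ r, r ≠ varReg x → r % 2 = 0 ∨ r < tmpReg d → s'.reg r = s.reg r) ∧
      (s'.reg (tmpReg d) ≠ 0 ↔
        ∃ i, j ≤ i ∧ i < n ∧ φ.Holds n s.mem (Function.update s.env x i))
    have hloop := Run.countdown (x := varReg x) (t := tmpReg (d + 2))
      (B := .seq (φ.compile (d + 2)) (.branch (tmpReg (d + 2)) (.const (tmpReg d) 1) .skip))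
      (T := φ.cost.eval n + (1 + 1)) (by simp only [varReg, tmpReg]; lia) Inv
      (fun _ _ h => h.2.1) n (by
        rintro j hj s' ⟨hm, h₁, h₂, hr, h₃⟩
        have henv : ((s'.setReg (tmpReg (d + 2)) 1).setReg (varReg x) j).env =
            Function.update s.env x j := by
          funext y
          by_cases hy : y = x
          · subst hy; simp [State.env]
          · have := hr (varReg y) (by simpa using hy) (by simp only [varReg]; lia)
            simp only [State.env, State.reg_setReg, varReg, tmpReg, Function.update_apply] at *
            grind
        refine Run.seq ((ih (d + 2) n _ ?_ ?_).mono le_rfl ?_)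
        · rw [← hn, ← hr 0 (by simp) (by simp)]; simp
        · rw [henv]
          intro y
          rw [Function.update_apply]
          split_ifs
          · lia
          · exact hs y
        · rintro s'' ⟨hsame, h⟩
          rw [henv, State.mem_setReg, State.mem_setReg, hm] at h
          have hreg : ∀ r, r % 2 = 0 ∨ r < tmpReg (d + 2) →
              s''.reg r = if r = varReg x then j else s'.reg r := by
            intro r hr'
            rw [hsame.2 r hr']
            simp only [State.reg_setReg, tmpReg] at *
            grind
          refine Run.branch (fun h0 => Run.const ⟨?_, ?_, ?_, fun r hr₁ hr₂ => ?_, ?_⟩)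
            (fun h0 => Run.skip ⟨?_, ?_, ?_, fun r hr₁ hr₂ => ?_, ?_⟩)
          · simpa [hm] using hsame.1
          · simp only [State.reg_setReg]
            rw [if_neg (by simp only [tmpReg, varReg]; lia), hreg _ (by simp), if_pos rfl]
          · simp only [State.reg_setReg]
            rw [if_neg (by simp only [tmpReg]; lia), hreg _ (by simp), if_neg (by simp; lia), h₂]
          · simp only [State.reg_setReg]
            rw [if_neg (by simp only [tmpReg] at *; lia), hreg _ (by simp only [tmpReg] at *; lia),
              if_neg hr₁, hr r hr₁ hr₂]
          · simpa using ⟨j, le_rfl, hj, h.1 h0⟩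
          · simpa [hm] using hsame.1
          · rw [hreg _ (by simp), if_pos rfl]
          · rw [hreg _ (by simp), if_neg (by simp; lia), h₂]
          · rw [hreg _ (by simp only [tmpReg] at *; lia), if_neg hr₁, hr r hr₁ hr₂]
          · rw [hreg _ (by simp), if_neg (by simp only [tmpReg, varReg]; lia), h₃]
            constructor
            · rintro ⟨i, hi, hi'⟩
              exact ⟨i, by lia, hi'⟩
            · rintro ⟨i, hi, hi', hi''⟩
              rcases hi.eq_or_lt with rfl | hlt
              · exact absurd h0 (h.2 hi'')
              · exact ⟨i, hlt, hi', hi''⟩)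
    refine (Run.seq (Run.const (Run.seq (Run.copy (Run.seq (Run.copy (Run.seq
      ((hloop _ ?_).mono le_rfl ?_)))))))).mono
      (T := 1 + (1 + (1 + ((n * (φ.cost.eval n + (1 + 1) + 3) + 1) + 1)))) ?_ fun _ h => h
    · refine ⟨rfl, ?_, ?_, fun r h₁ h₂ => ?_, ?_⟩
      · simp [hn]
      · simp only [State.reg_setReg, tmpReg, varReg]; grind
      · simp only [State.reg_setReg, tmpReg, varReg] at *; grind
      · simp only [State.reg_setReg, tmpReg, varReg] at *
        simp
        grind
    · rintro s' ⟨hm, h₁, h₂, hr, h₃⟩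
      refine Run.copy ⟨⟨hm, fun r hr' => ?_⟩, ?_⟩
      · by_cases hrx : r = varReg x
        · simp [hrx, h₂]
        · simp only [State.reg_setReg, if_neg hrx, hr r hrx hr']
      · rw [State.reg_setReg, if_neg (by simp only [tmpReg, varReg]; lia), h₃]
        simp [Fml.Holds]
    · simp [Fml.cost]; lia

/-! ### Statements -/

/-- Statements: formulas may be stored, statements may be run one after the other, and for all
values of a variable below `n`, in descending order. -/
inductive Stmt : Type
  /-- the cell of bank `b` with address `x` becomes `1` or `0` according to the truth of `φ` -/
  | set (b x : ℕ) (φ : Fml)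
  /-- first `S`, then `S'` -/
  | seq (S S' : Stmt)
  /-- `S` for `x = n - 1, …, 0` -/
  | each (x : ℕ) (S : Stmt)

/-- Apply `f (N - 1)`, …, `f 0` in this order. -/
def loopDown {α : Type*} (f : ℕ → α → α) : ℕ → α → α
  | 0, m => m
  | N + 1, m => loopDown f N (f N m)

/-- An invariant of `loopDown`: `Inv j` holds when `f i` has been applied for the `i ≥ j`. -/
theorem loopDown_induct {α : Type*} {f : ℕ → α → α} (Inv : ℕ → α → Prop) {N : ℕ} {m : α}
    (h : Inv N m) (hf : ∀ j < N, ∀ m, Inv (j + 1) m → Inv j (f j m)) : Inv 0 (loopDown f N m) := by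
  induction N generalizing m with
  | zero => exact h
  | succ N ih => exact ih (hf N (by lia) m h) fun j hj => hf j (by lia)

open Classical in
/-- The memory after a statement, for given values of the variables. -/
noncomputable def Stmt.sem (n : ℕ) : Stmt → (ℕ → ℕ) → (ℕ → ℕ → ℕ) → ℕ → ℕ → ℕ
  | .set b x φ, ρ, m =>
    Function.update m b (Function.update (m b) (ρ x) (if φ.Holds n m ρ then 1 else 0))
  | .seq S S', ρ, m => S'.sem n ρ (S.sem n ρ m)
  | .each x S, ρ, m => loopDown (fun j => S.sem n (Function.update ρ x j)) n m

/-- A program that runs a statement. It restores the variables and does not touch the temporary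
registers below `d`. -/
def Stmt.compile : Stmt → ℕ → Prog
  | .set b x φ, d =>
    .seq (φ.compile d) <|
    .seq (.branch (tmpReg d) (.const (tmpReg d) 1) (.const (tmpReg d) 0)) <|
    .store b (varReg x) (tmpReg d)
  | .seq S S', d => .seq (S.compile d) (S'.compile d)
  | .each x S, d =>
    .seq (.copy (tmpReg d) (varReg x)) <| .seq (.copy (varReg x) 0) <|
    .seq (countdown (varReg x) (tmpReg (d + 1)) (S.compile (d + 1))) <|
    .copy (varReg x) (tmpReg d)

/-- A bound on the running time of `Stmt.compile`, as a polynomial in `n`. -/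
noncomputable def Stmt.cost : Stmt → Polynomial ℕ
  | .set _ _ φ => φ.cost + 3
  | .seq S S' => S.cost + S'.cost
  | .each _ S => .X * (S.cost + 3) + 4

theorem Stmt.run_compile (S : Stmt) : ∀ (d n : ℕ) (s : State), s.reg 0 = n →
    (∀ x, s.env x ≤ n) → Run (S.compile d) s (S.cost.eval n) fun s' =>
      s'.mem = S.sem n s.env s.mem ∧ ∀ r, r % 2 = 0 ∨ r < tmpReg d → s'.reg r = s.reg r := by
  induction S with
  | set b x φ =>
    intro d n s hn hs
    refine (Run.seq ((φ.run_compile d n s hn hs).mono le_rfl ?_)).mono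
      (T := φ.cost.eval n + (2 + 1)) (by simp [Stmt.cost]) fun _ h => h
    rintro s' ⟨⟨hm, hr⟩, h⟩
    have hx : s'.reg (varReg x) = s.env x := hr (varReg x) (by simp only [varReg]; lia)
    have hne : varReg x ≠ tmpReg d := by simp only [varReg, tmpReg]; lia
    refine Run.seq (Run.branch (fun h0 => Run.const (Run.store ⟨?_, fun r hr' => ?_⟩))
      (fun h0 => Run.const (Run.store ⟨?_, fun r hr' => ?_⟩)))
    · simp [hm, Stmt.sem, h.1 h0, hne, hx]
    · rw [← hr r hr']; simp only [State.reg_setReg, State.reg_setMem, tmpReg] at *; grind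
    · have h' : ¬ φ.Holds n s.mem s.env := fun h' => h.2 h' h0
      simp [hm, Stmt.sem, h', hne, hx]
    · rw [← hr r hr']; simp only [State.reg_setReg, State.reg_setMem, tmpReg] at *; grind
  | seq S S' ih ih' =>
    intro d n s hn hs
    refine (Run.seq ((ih d n s hn hs).mono le_rfl ?_)).mono
      (T := S.cost.eval n + S'.cost.eval n) (by simp [Stmt.cost]) fun _ h => h
    rintro s' ⟨hm, hr⟩
    have henv : s'.env = s.env := by funext x; exact hr _ (by simp only [varReg]; lia)
    refine (ih' d n s' (by rw [hr 0 (by simp), hn]) (by rwa [henv])).mono le_rfl ?_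
    rintro s'' ⟨hm', hr'⟩
    exact ⟨by rw [hm', hm, henv]; rfl, fun r h => (hr' r h).trans (hr r h)⟩
  | each x S ih =>
    intro d n s hn hs
    let f (j : ℕ) := S.sem n (Function.update s.env x j)
    -- what remains to be done at value `j` leads to the final memory
    let Inv (j : ℕ) (s' : State) : Prop := loopDown f j s'.mem = loopDown f n s.mem ∧
      s'.reg (varReg x) = j ∧ s'.reg (tmpReg d) = s.reg (varReg x) ∧
      ∀ r, r ≠ varReg x → r % 2 = 0 ∨ r < tmpReg d → s'.reg r = s.reg r
    have hloop := Run.countdown (x := varReg x) (t := tmpReg (d + 1)) (B := S.compile (d + 1))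
      (T := S.cost.eval n) (by simp only [varReg, tmpReg]; lia) Inv (fun _ _ h => h.2.1) n (by
        rintro j hj s' ⟨hm, h₁, h₂, hr⟩
        have henv : ((s'.setReg (tmpReg (d + 1)) 1).setReg (varReg x) j).env =
            Function.update s.env x j := by
          funext y
          by_cases hy : y = x
          · subst hy; simp [State.env]
          · have := hr (varReg y) (by simpa using hy) (by simp only [varReg]; lia)
            simp only [State.env, State.reg_setReg, varReg, tmpReg, Function.update_apply] at *
            grind
        refine (ih (d + 1) n _ ?_ ?_).mono le_rfl ?_
        · rw [← hn, ← hr 0 (by simp) (by simp)]; simp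
        · rw [henv]
          intro y
          rw [Function.update_apply]
          split_ifs
          · lia
          · exact hs y
        · rintro s'' ⟨hm', hr'⟩
          rw [henv, State.mem_setReg, State.mem_setReg] at hm'
          have hreg : ∀ r, r % 2 = 0 ∨ r < tmpReg (d + 1) →
              s''.reg r = if r = varReg x then j else s'.reg r := by
            intro r h
            rw [hr' r h]
            simp only [State.reg_setReg, tmpReg] at *
            grind
          refine ⟨by rw [hm', ← hm]; rfl, ?_, ?_, fun r hr₁ hr₂ => ?_⟩
          · rw [hreg _ (by simp), if_pos rfl]
          · rw [hreg _ (by simp), if_neg (by simp; lia), h₂]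
          · rw [hreg _ (by simp only [tmpReg] at *; lia), if_neg hr₁, hr r hr₁ hr₂])
    refine (Run.seq (Run.copy (Run.seq (Run.copy (Run.seq ((hloop _ ?_).mono le_rfl ?_)))))).mono
      (T := 1 + (1 + ((n * (S.cost.eval n + 3) + 1) + 1))) ?_ fun _ h => h
    · refine ⟨rfl, ?_, ?_, fun r h₁ h₂ => ?_⟩
      · simp [hn]
      · simp only [State.reg_setReg, tmpReg, varReg]; grind
      · simp only [State.reg_setReg, tmpReg, varReg] at *; grind
    · rintro s' ⟨hm, h₁, h₂, hr⟩
      refine Run.copy ⟨hm, fun r hr' => ?_⟩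
      by_cases hrx : r = varReg x
      · simp [hrx, h₂]
      · simp only [State.reg_setReg, if_neg hrx, hr r hrx hr']
    · simp [Stmt.cost]; lia

end RAM

namespace RAM

/-! ### The algorithm

Variables: `0` is never bound and has value `0`, `1` and `2` run over vertices, `3` is the start
of a search, `4` counts the rounds of a search, and `5 + 2 * i`, `6 + 2 * i` are the vertices
`v i`, `u i` of the `i`-th pair. Banks: `0` is the adjacency matrix, `1` holds the independent set,
`2` the vertices reached by the search, and cell `0` of bank `3` the answer. -/

/-- Vertex `1` is forbidden by the first `k` pairs. -/
def forbiddenFml : ℕ → Fml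
  | 0 => .lt 0 0
  | k + 1 => (forbiddenFml k).disj
      (.conj (.lt (5 + 2 * k) 1) (.disj (.adj 1 (5 + 2 * k)) (.adj 1 (6 + 2 * k))))

/-- Compute the greedy independent set for the first `k` pairs. -/
def greedyStmt (k : ℕ) : Stmt :=
  .each 1 <| .set 1 1 <| .conj (.neg (forbiddenFml k))
    (.neg (.ex 2 (.conj (.lt 1 2) (.conj (.bit 1 2) (.adj 1 2)))))

/-- Start a search at vertex `3`. -/
def initStmt : Stmt :=
  .each 1 <| .set 2 1 <| .conj (.neg (.lt 1 3)) (.neg (.lt 3 1))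

/-- One round of a search that avoids the independent set. -/
def roundStmt : Stmt :=
  .each 1 <| .set 2 1 <| .disj (.bit 2 1)
    (.conj (.neg (.bit 1 1)) (.ex 2 (.conj (.bit 2 2) (.adj 1 2))))

/-- Set the answer if vertex `3` and some vertex that was not reached lie outside the independent
set. -/
def flagStmt : Stmt :=
  .set 3 0 <| .disj (.bit 3 0)
    (.conj (.neg (.bit 1 3)) (.ex 2 (.conj (.neg (.bit 1 2)) (.neg (.bit 2 2)))))

/-- Search from vertex `3`, and set the answer if not every vertex outside the independent set
has been reached. -/
def searchStmt : Stmt :=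
  .seq (.seq initStmt (.each 4 roundStmt)) flagStmt

/-- Compute the greedy independent set for the first `k` pairs and test whether it is a cutset. -/
def testStmt (k : ℕ) : Stmt :=
  .seq (greedyStmt k) (.each 3 searchStmt)

/-- Run a statement for all values of the first `k` pairs. -/
def forPairs : ℕ → Stmt → Stmt
  | 0, S => S
  | k + 1, S => .each (5 + 2 * k) (.each (6 + 2 * k) (forPairs k S))

/-! ### Correctness of the algorithm -/

theorem Stmt.sem_set_of_ne {n b x : ℕ} {φ : Fml} {ρ : ℕ → ℕ} {m : ℕ → ℕ → ℕ} {b' : ℕ}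
    (h : b' ≠ b) : (Stmt.set b x φ).sem n ρ m b' = m b' := by
  simp [Stmt.sem, h]

theorem Stmt.sem_set_ne_zero {n b x : ℕ} {φ : Fml} {ρ : ℕ → ℕ} {m : ℕ → ℕ → ℕ} {y : ℕ} :
    (Stmt.set b x φ).sem n ρ m b y ≠ 0 ↔ if y = ρ x then φ.Holds n m ρ else m b y ≠ 0 := by
  by_cases h : y = ρ x <;> simp [Stmt.sem, h]

/-- On memories satisfying `K`, and for values `ρ` of the variables that are below `n` (with value
`0` for variable `0`, the address of the answer), the statement `S` preserves `K`, and it sets the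
answer if and only if `Φ ρ` holds. -/
def Accumulates (n : ℕ) (K : (ℕ → ℕ → ℕ) → Prop) (S : Stmt) (Φ : (ℕ → ℕ) → Prop) : Prop :=
  ∀ ρ m, ρ 0 = 0 → (∀ x, ρ x < n) → K m →
    K (S.sem n ρ m) ∧ (S.sem n ρ m 3 0 ≠ 0 ↔ m 3 0 ≠ 0 ∨ Φ ρ)

theorem Accumulates.each {n : ℕ} {K : (ℕ → ℕ → ℕ) → Prop} {S : Stmt} {Φ : (ℕ → ℕ) → Prop}
    (h : Accumulates n K S Φ) {x : ℕ} (hx : x ≠ 0) :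
    Accumulates n K (.each x S) fun ρ => ∃ j < n, Φ (Function.update ρ x j) := by
  intro ρ m hρ hlt hK
  have := loopDown_induct (f := fun j => S.sem n (Function.update ρ x j)) (N := n) (m := m)
    (fun j m' => K m' ∧ (m' 3 0 ≠ 0 ↔
      m 3 0 ≠ 0 ∨ ∃ i, j ≤ i ∧ i < n ∧ Φ (Function.update ρ x i)))
    ⟨hK, by
      have : ¬ ∃ i, n ≤ i ∧ i < n ∧ Φ (Function.update ρ x i) := by
        rintro ⟨i, h₁, h₂, -⟩; lia
      simp [this]⟩ ?_
  · simpa [Stmt.sem] using this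
  · rintro j hj m' ⟨hK', hm'⟩
    obtain ⟨h₁, h₂⟩ := h (Function.update ρ x j) m' (by simp [hx.symm, hρ])
      (fun y => by rw [Function.update_apply]; split_ifs <;> simp [hj, hlt]) hK'
    refine ⟨h₁, h₂.trans ?_⟩
    rw [hm', or_assoc]
    refine or_congr_right ⟨?_, ?_⟩
    · rintro (⟨i, hi, hi', hΦ⟩ | hΦ)
      · exact ⟨i, by lia, hi', hΦ⟩
      · exact ⟨j, le_rfl, hj, hΦ⟩
    · rintro ⟨i, hi, hi', hΦ⟩
      rcases hi.eq_or_lt with rfl | hlt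
      · exact .inr hΦ
      · exact .inl ⟨i, hlt, hi', hΦ⟩

theorem Accumulates.forPairs {n : ℕ} {K : (ℕ → ℕ → ℕ) → Prop} {S : Stmt} {Φ : (ℕ → ℕ) → Prop}
    (h : Accumulates n K S Φ) (k : ℕ) :
    Accumulates n K (forPairs k S) fun ρ => ∃ ρ' : ℕ → ℕ,
      (∀ x < 5 + 2 * k, 5 ≤ x → ρ' x < n) ∧ (∀ x, x < 5 ∨ 5 + 2 * k ≤ x → ρ' x = ρ x) ∧ Φ ρ' := by
  induction k with
  | zero =>
    intro ρ m hρ hlt hK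
    obtain ⟨h₁, h₂⟩ := h ρ m hρ hlt hK
    refine ⟨h₁, h₂.trans (or_congr_right ⟨fun hΦ => ⟨ρ, by lia, fun _ _ => rfl, hΦ⟩, ?_⟩)⟩
    rintro ⟨ρ', -, h', hΦ⟩
    rwa [← funext fun x => h' x (by lia)]
  | succ k ih =>
    intro ρ m hρ hlt hK
    obtain ⟨h₁, h₂⟩ :=
      (ih.each (x := 6 + 2 * k) (by lia)).each (x := 5 + 2 * k) (by lia)
        ρ m hρ hlt hK
    refine ⟨h₁, h₂.trans (or_congr_right ⟨?_, ?_⟩)⟩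
    · rintro ⟨i, hi, j, hj, ρ', hlt, heq, hΦ⟩
      have hi' := heq (5 + 2 * k) (by lia)
      have hj' := heq (6 + 2 * k) (by lia)
      simp only [Function.update_apply] at hi' hj'
      refine ⟨ρ', fun x hx hx' => ?_, fun x hx => ?_, hΦ⟩
      · grind
      · rw [heq x (by lia), Function.update_of_ne (by lia), Function.update_of_ne (by lia)]
    · rintro ⟨ρ', hlt, heq, hΦ⟩
      refine ⟨ρ' (5 + 2 * k), hlt _ (by lia) (by lia), ρ' (6 + 2 * k), hlt _ (by lia) (by lia),
        ρ', fun x hx hx' => hlt x (by lia) hx', fun x hx => ?_, hΦ⟩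
      simp only [Function.update_apply]
      grind

/-- The relation that is stored in bank `0`. -/
def Edge (n : ℕ) (A : ℕ → ℕ) (i j : ℕ) : Prop := A (i * n + j) ≠ 0

theorem holds_forbiddenFml {n : ℕ} {m : ℕ → ℕ → ℕ} {ρ : ℕ → ℕ} {k : ℕ} :
    (forbiddenFml k).Holds n m ρ ↔ Forbidden (Edge n (m 0)) (fun i => ρ (6 + 2 * i))
      (fun i => ρ (5 + 2 * i)) k (ρ 1) := by
  induction k with
  | zero => simp [forbiddenFml, Fml.Holds, Forbidden]
  | succ k ih =>
    rw [forbidden_succ, forbiddenFml, Fml.holds_disj, ih]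
    simp only [Fml.Holds, Fml.holds_disj, Edge]

theorem sem_greedyStmt (n k : ℕ) (ρ : ℕ → ℕ) (m : ℕ → ℕ → ℕ) :
    (∀ b ≠ 1, (greedyStmt k).sem n ρ m b = m b) ∧
    ∀ x < n, (greedyStmt k).sem n ρ m 1 x ≠ 0 ↔
      ¬ Forbidden (Edge n (m 0)) (fun i => ρ (6 + 2 * i)) (fun i => ρ (5 + 2 * i)) k x ∧
      ¬ ∃ y < n, x < y ∧ (greedyStmt k).sem n ρ m 1 y ≠ 0 ∧ Edge n (m 0) x y := by
  have := loopDown_induct (N := n) (m := m)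
    (f := fun j => Stmt.sem n (.set 1 1 <| .conj (.neg (forbiddenFml k))
      (.neg (.ex 2 (.conj (.lt 1 2) (.conj (.bit 1 2) (.adj 1 2)))))) (Function.update ρ 1 j))
    (fun j m' => (∀ b ≠ 1, m' b = m b) ∧ ∀ x < n, j ≤ x → (m' 1 x ≠ 0 ↔
      ¬ Forbidden (Edge n (m 0)) (fun i => ρ (6 + 2 * i)) (fun i => ρ (5 + 2 * i)) k x ∧
      ¬ ∃ y < n, x < y ∧ m' 1 y ≠ 0 ∧ Edge n (m 0) x y))
    ⟨fun _ _ => rfl, by lia⟩ ?_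
  · exact ⟨this.1, fun x hx => this.2 x hx (by lia)⟩
  · rintro j hj m' ⟨h₁, h₂⟩
    refine ⟨fun b hb => (Stmt.sem_set_of_ne hb).trans (h₁ b hb), fun x hx hjx => ?_⟩
    have h0 := h₁ 0 (by simp)
    -- cells above `x ≥ j` are the same before and after this step
    have hex : (∃ y < n, x < y ∧ Stmt.sem n (.set 1 1 <| .conj (.neg (forbiddenFml k))
          (.neg (.ex 2 (.conj (.lt 1 2) (.conj (.bit 1 2) (.adj 1 2)))))) (Function.update ρ 1 j)
          m' 1 y ≠ 0 ∧ Edge n (m 0) x y) ↔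
        ∃ y < n, x < y ∧ m' 1 y ≠ 0 ∧ Edge n (m 0) x y := by
      refine exists_congr fun y => and_congr_right fun _ => and_congr_right fun hy => ?_
      rw [Stmt.sem_set_ne_zero, if_neg (by simp; lia)]
    rw [hex, Stmt.sem_set_ne_zero, Function.update_self]
    rcases hjx.eq_or_lt with rfl | hlt
    · rw [if_pos rfl]
      simp only [Fml.Holds, holds_forbiddenFml, h0]
      have h5 : ∀ i, 5 + 2 * i ≠ 1 := by lia
      have h6 : ∀ i, 6 + 2 * i ≠ 1 := by lia
      simp [Edge, h5, h6]
    · rw [if_neg (by lia)]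
      exact h₂ x hx hlt

theorem sem_initStmt (n : ℕ) (ρ : ℕ → ℕ) (m : ℕ → ℕ → ℕ) :
    (∀ b ≠ 2, initStmt.sem n ρ m b = m b) ∧
    ∀ x < n, initStmt.sem n ρ m 2 x ≠ 0 ↔ x = ρ 3 := by
  have := loopDown_induct (N := n) (m := m)
    (f := fun j => Stmt.sem n (.set 2 1 <| .conj (.neg (.lt 1 3)) (.neg (.lt 3 1)))
      (Function.update ρ 1 j))
    (fun j m' => (∀ b ≠ 2, m' b = m b) ∧ ∀ x < n, j ≤ x → (m' 2 x ≠ 0 ↔ x = ρ 3))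
    ⟨fun _ _ => rfl, by lia⟩ ?_
  · exact ⟨this.1, fun x hx => this.2 x hx (by lia)⟩
  · rintro j hj m' ⟨h₁, h₂⟩
    refine ⟨fun b hb => (Stmt.sem_set_of_ne hb).trans (h₁ b hb), fun x hx hjx => ?_⟩
    rw [Stmt.sem_set_ne_zero, Function.update_self]
    rcases hjx.eq_or_lt with rfl | hlt
    · rw [if_pos rfl]
      simp [Fml.Holds]
      lia
    · rw [if_neg (by lia)]
      exact h₂ x hx hlt

/-- One round reaches all neighbours, outside the independent set, of the vertices reached so
far, and no vertex outside a set `P` closed under taking such neighbours. -/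
theorem sem_roundStmt (n : ℕ) (ρ : ℕ → ℕ) (m : ℕ → ℕ → ℕ) :
    (∀ b ≠ 2, roundStmt.sem n ρ m b = m b) ∧
    (∀ x < n, (m 2 x ≠ 0 ∨ m 1 x = 0 ∧ ∃ y < n, m 2 y ≠ 0 ∧ Edge n (m 0) x y) →
      roundStmt.sem n ρ m 2 x ≠ 0) ∧
    ∀ P : ℕ → Prop, (∀ x < n, ∀ y < n, P y → Edge n (m 0) x y → m 1 x = 0 → P x) →
      (∀ x < n, m 2 x ≠ 0 → P x) → ∀ x < n, roundStmt.sem n ρ m 2 x ≠ 0 → P x := by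
  have := loopDown_induct (N := n) (m := m)
    (f := fun j => Stmt.sem n (.set 2 1 <| .disj (.bit 2 1)
      (.conj (.neg (.bit 1 1)) (.ex 2 (.conj (.bit 2 2) (.adj 1 2))))) (Function.update ρ 1 j))
    (fun j m' => (∀ b ≠ 2, m' b = m b) ∧ (∀ x < n, m 2 x ≠ 0 → m' 2 x ≠ 0) ∧
      (∀ x < n, j ≤ x → (m 1 x = 0 ∧ ∃ y < n, m 2 y ≠ 0 ∧ Edge n (m 0) x y) → m' 2 x ≠ 0) ∧
      ∀ P : ℕ → Prop, (∀ x < n, ∀ y < n, P y → Edge n (m 0) x y → m 1 x = 0 → P x) →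
        (∀ x < n, m 2 x ≠ 0 → P x) → ∀ x < n, m' 2 x ≠ 0 → P x)
    ⟨fun _ _ => rfl, fun _ _ h => h, by lia, fun _ _ h => h⟩ ?_
  · refine ⟨this.1, fun x hx h => ?_, this.2.2.2⟩
    exact h.elim (this.2.1 x hx) (this.2.2.1 x hx (by lia))
  · rintro j hj m' ⟨h₁, h₂, h₃, h₄⟩
    have h0 := h₁ 0 (by simp)
    have h1 := h₁ 1 (by simp)
    have hcell : ∀ x, Stmt.sem n (.set 2 1 <| .disj (.bit 2 1)
        (.conj (.neg (.bit 1 1)) (.ex 2 (.conj (.bit 2 2) (.adj 1 2))))) (Function.update ρ 1 j)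
        m' 2 x ≠ 0 ↔ if x = j then
          m' 2 x ≠ 0 ∨ m 1 x = 0 ∧ ∃ y < n, m' 2 y ≠ 0 ∧ Edge n (m 0) x y else m' 2 x ≠ 0 := by
      intro x
      rw [Stmt.sem_set_ne_zero, Function.update_self]
      split_ifs with h
      · subst h
        simp [Fml.holds_disj, Fml.Holds, h0, h1, Edge]
      · rfl
    refine ⟨fun b hb => (Stmt.sem_set_of_ne hb).trans (h₁ b hb), fun x hx h => ?_,
      fun x hx hjx h => ?_, fun P hP hP' x hx h => ?_⟩
    · rw [hcell]
      split_ifs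
      · exact .inl (h₂ x hx h)
      · exact h₂ x hx h
    · rw [hcell]
      split_ifs with hxj
      · obtain ⟨hx1, y, hy, hy', he⟩ := h
        exact .inr ⟨hx1, y, hy, h₂ y hy hy', he⟩
      · exact h₃ x hx (by lia) h
    · rw [hcell] at h
      split_ifs at h
      · rcases h with h | ⟨hx1, y, hy, hy', he⟩
        · exact h₄ P hP hP' x hx h
        · exact hP x hx y hy (h₄ P hP hP' y hy hy') he hx1
      · exact h₄ P hP hP' x hx h

variable {n : ℕ} {G : SimpleGraph (Fin n)} {A : ℕ → ℕ}

/-- Paths have length less than `n`, so `n` rounds reach the whole component of the start. -/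
theorem sem_flood (hA : ∀ i j : Fin n, Edge n A i j ↔ G.Adj i j) (ρ : ℕ → ℕ) (m : ℕ → ℕ → ℕ)
    (hm : m 0 = A) :
    (∀ b ≠ 2, Stmt.sem n (.seq initStmt (.each 4 roundStmt)) ρ m b = m b) ∧
    ∀ a x : ({x : Fin n | m 1 x ≠ 0}ᶜ : Set (Fin n)), a.1.1 = ρ 3 →
      (Stmt.sem n (.seq initStmt (.each 4 roundStmt)) ρ m 2 x.1 ≠ 0 ↔
        (G.induce {x : Fin n | m 1 x ≠ 0}ᶜ).Reachable x a) := by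
  set H := G.induce {x : Fin n | m 1 x ≠ 0}ᶜ with hH
  -- with `j` rounds to go, all walks to the start of length at most `n - j` have been followed
  have := loopDown_induct (N := n) (m := initStmt.sem n ρ m)
    (f := fun j => roundStmt.sem n (Function.update ρ 4 j))
    (fun j m' => (∀ b ≠ 2, m' b = m b) ∧ ∀ a : ({x : Fin n | m 1 x ≠ 0}ᶜ : Set (Fin n)),
      a.1.1 = ρ 3 →
      (∀ x, (∃ p : H.Walk x a, p.length + j ≤ n) → m' 2 x.1 ≠ 0) ∧
      ∀ y < n, m' 2 y ≠ 0 → ∃ x, x.1.1 = y ∧ H.Reachable x a) ?_ ?_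
  · refine ⟨this.1, fun a x ha => ⟨fun h => ?_, fun h => ?_⟩⟩
    · obtain ⟨y, hy, hr⟩ := (this.2 a ha).2 x.1 x.1.2 h
      rwa [← Subtype.ext (Fin.ext hy)]
    · obtain ⟨p, hp⟩ := h.exists_isPath
      refine (this.2 a ha).1 x ⟨p, ?_⟩
      classical
      have h₁ := hp.length_lt
      have h₂ := Fintype.card_subtype_le (· ∈ ({x : Fin n | m 1 x ≠ 0}ᶜ : Set (Fin n)))
      rw [Fintype.card_fin] at h₂
      lia
  · obtain ⟨h₁, h₂⟩ := sem_initStmt n ρ m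
    refine ⟨h₁, fun a ha => ⟨?_, fun y hy h => ⟨a, ?_, .refl _⟩⟩⟩
    · rintro x ⟨p, hp⟩
      rw [h₂ x.1 x.1.2, SimpleGraph.Walk.eq_of_length_eq_zero (p := p) (by lia), ha]
    · rw [ha, ← (h₂ y hy).1 h]
  · rintro j hj m' ⟨h₁, h₂⟩
    have h0 : m' 0 = A := (h₁ 0 (by simp)).trans hm
    have h1 : m' 1 = m 1 := h₁ 1 (by simp)
    obtain ⟨h₃, h₄, h₅⟩ := sem_roundStmt n (Function.update ρ 4 j) m'
    rw [h0, h1] at h₄ h₅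
    refine ⟨fun b hb => (h₃ b hb).trans (h₁ b hb), fun a ha => ⟨?_, ?_⟩⟩
    · rintro x ⟨p, hp⟩
      refine h₄ x.1 x.1.2 ?_
      cases p with
      | nil => exact .inl ((h₂ a ha).1 a ⟨.nil, by simp; lia⟩)
      | cons hadj q =>
        rename_i y
        refine .inr ⟨of_not_not x.2, y.1, y.1.2, (h₂ a ha).1 y ⟨q, ?_⟩, (hA _ _).2 hadj⟩
        simp at hp
        lia
    · refine h₅ (fun y => ∃ x, x.1.1 = y ∧ H.Reachable x a) ?_ (h₂ a ha).2
      rintro x hx _ hy ⟨y, rfl, hr⟩ he hx1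
      refine ⟨⟨⟨x, hx⟩, by simpa using hx1⟩, rfl, SimpleGraph.Reachable.trans ?_ hr⟩
      exact SimpleGraph.Adj.reachable ((hA ⟨x, hx⟩ y.1).1 he)

theorem accumulates_searchStmt (hA : ∀ i j : Fin n, Edge n A i j ↔ G.Adj i j) (I : ℕ → ℕ) :
    Accumulates n (fun m => m 0 = A ∧ m 1 = I) searchStmt fun ρ =>
      ∃ a x : ({x : Fin n | I x ≠ 0}ᶜ : Set (Fin n)), a.1.1 = ρ 3 ∧
        ¬ (G.induce {x : Fin n | I x ≠ 0}ᶜ).Reachable x a := by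
  rintro ρ m hρ hlt ⟨hm, rfl⟩
  obtain ⟨h₁, h₂⟩ := sem_flood hA ρ m hm
  set m' := Stmt.sem n (.seq initStmt (.each 4 roundStmt)) ρ m with hm'
  have hsem : searchStmt.sem n ρ m = flagStmt.sem n ρ m' := rfl
  rw [hsem, flagStmt, Stmt.sem_set_ne_zero, hρ, if_pos rfl, Fml.holds_disj]
  refine ⟨⟨?_, ?_⟩, ?_⟩
  · rw [Stmt.sem_set_of_ne (by simp), h₁ 0 (by simp), hm]
  · rw [Stmt.sem_set_of_ne (by simp), h₁ 1 (by simp)]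
  simp only [Fml.Holds, hρ, h₁ 3 (by simp), h₁ 1 (by simp), not_not, ne_eq,
    Function.update_self]
  refine or_congr_right ⟨?_, ?_⟩
  · rintro ⟨ha, y, hy, hy1, hy2⟩
    refine ⟨⟨⟨ρ 3, hlt 3⟩, by simpa using ha⟩, ⟨⟨y, hy⟩, by simpa using hy1⟩, rfl, ?_⟩
    rwa [← h₂ _ _ rfl, not_not]
  · rintro ⟨a, x, ha, hr⟩
    rw [← h₂ _ _ ha, not_not] at hr
    exact ⟨ha ▸ of_not_not a.2, x.1, x.1.2, of_not_not x.2, hr⟩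

theorem accumulates_testStmt (hA : ∀ i j : Fin n, Edge n A i j ↔ G.Adj i j) (k : ℕ) :
    Accumulates n (fun m => m 0 = A) (testStmt k) fun ρ => ∃ I : Fin n → Prop,
      IsGreedy G.Adj (fun x => Forbidden (Edge n A) (fun i => ρ (6 + 2 * i))
        (fun i => ρ (5 + 2 * i)) k x) I ∧ IsCutset G {x | I x} := by
  rintro ρ m hρ hlt rfl
  obtain ⟨h₁, h₂⟩ := sem_greedyStmt n k ρ m
  set m' := (greedyStmt k).sem n ρ m with hm'
  obtain ⟨h₃, h₄⟩ := (accumulates_searchStmt hA (m' 1)).each (x := 3) (by simp) ρ m' hρ hlt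
    ⟨h₁ 0 (by simp), rfl⟩
  have hgreedy : IsGreedy G.Adj (fun x => Forbidden (Edge n (m 0)) (fun i => ρ (6 + 2 * i))
      (fun i => ρ (5 + 2 * i)) k x) fun x => m' 1 x ≠ 0 := by
    intro x
    refine (h₂ x x.2).trans ?_
    refine and_congr_right fun _ => not_congr ⟨?_, ?_⟩
    · rintro ⟨y, hy, hxy, hy', he⟩
      exact ⟨⟨y, hy⟩, hxy, hy', (hA x ⟨y, hy⟩).1 he⟩
    · rintro ⟨y, hxy, hy', he⟩
      exact ⟨y, y.2, hxy, hy', (hA x y).2 he⟩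
  refine ⟨h₃.1, h₄.trans ?_⟩
  rw [h₁ 3 (by simp)]
  refine or_congr_right ⟨?_, ?_⟩
  · rintro ⟨j, hj, a, x, -, hr⟩
    exact ⟨_, hgreedy, fun h => hr (h x a)⟩
  · rintro ⟨I, hI, hcut⟩
    obtain rfl : I = fun x : Fin n => m' 1 x ≠ 0 := funext fun x => propext (hI.unique hgreedy x)
    simp only [IsCutset, SimpleGraph.Preconnected, not_forall] at hcut
    obtain ⟨x, a, hr⟩ := hcut
    exact ⟨a.1, a.1.2, a, x, by simp, hr⟩

theorem edge_input (G : SimpleGraph (Fin n)) (i j : Fin n) :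
    Edge n ((input G).mem 0) i j ↔ G.Adj i j := by
  have hn : 0 < n := i.pos
  simp only [Edge, input, true_and, ne_eq, ite_eq_right_iff, one_ne_zero, imp_false, not_not]
  refine ⟨?_, fun h => ⟨i, j, rfl, h⟩⟩
  rintro ⟨i', j', h, hadj⟩
  have hj : j.1 = j'.1 := by
    have := congrArg (· % n) h
    simpa [Nat.mul_add_mod_self_right, Nat.mod_eq_of_lt] using this
  have hi : i.1 = i'.1 := by
    rw [hj, Nat.add_right_cancel_iff] at h
    exact Nat.eq_of_mul_eq_mul_right hn h
  rwa [Fin.ext hi, Fin.ext hj]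

theorem forbidden_val {u v : ℕ → Fin n} {u' v' : ℕ → ℕ}
    (hA : ∀ i j : Fin n, Edge n A i j ↔ G.Adj i j) {k : ℕ} (hu : ∀ i < k, u' i = u i)
    (hv : ∀ i < k, v' i = v i) (x : Fin n) :
    Forbidden (Edge n A) u' v' k x ↔ Forbidden G.Adj u v k x := by
  refine exists_congr fun i => and_congr_right fun hi => ?_
  rw [hu i hi, hv i hi, hA, hA, Fin.lt_def]

end RAM

theorem mainTheorem12 (t : ℕ) (ht : 1 ≤ t) :
    RAM.SolvableInPolyTime
      (fun _ G => G.Connected ∧ IsFreeOf (copiesOfK2 t) G)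
      (fun _ G => HasIndependentCutset G) := by
  refine ⟨.seq ((RAM.forPairs t (RAM.testStmt t)).compile 0)
    (.seq (.load 0 3 (RAM.varReg 0)) (.branch 0 (.const 0 1) (.const 0 0))),
    (RAM.forPairs t (RAM.testStmt t)).cost + 3, fun n G ⟨hG, hfree⟩ => ?_⟩
  have hn : 0 < n := hG.nonempty.elim fun x => x.pos
  have : NeZero n := ⟨hn.ne'⟩
  have henv : (RAM.input G).env = fun _ => 0 := funext fun x => by
    simp [RAM.State.env, RAM.input]
  obtain ⟨hm, hacc⟩ := (RAM.accumulates_testStmt (RAM.edge_input G) t).forPairs t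
    (RAM.input G).env (RAM.input G).mem (by rw [henv]) (fun x => by rwa [henv]) rfl
  have hans : (RAM.forPairs t (RAM.testStmt t)).sem n (RAM.input G).env (RAM.input G).mem 3 0 ≠ 0 ↔
      HasIndependentCutset G := by
    rw [hacc, hG.hasIndependentCutset_iff_exists_isGreedy hfree]
    have h0 : (RAM.input G).mem 3 0 = 0 := by simp [RAM.input]
    simp only [h0, ne_eq, not_true_eq_false, false_or]
    constructor
    · rintro ⟨ρ, hlt, -, I, hI, hcut⟩
      refine ⟨fun i => Fin.ofNat n (ρ (6 + 2 * i)), fun i => Fin.ofNat n (ρ (5 + 2 * i)), I, ?_,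
        hcut⟩
      convert hI using 2 with x
      refine (RAM.forbidden_val (RAM.edge_input G) (fun i hi => ?_) (fun i hi => ?_) x).symm
      · simp [Nat.mod_eq_of_lt (hlt (6 + 2 * i) (by lia) (by lia))]
      · simp [Nat.mod_eq_of_lt (hlt (5 + 2 * i) (by lia) (by lia))]
    · rintro ⟨u, v, I, hI, hcut⟩
      -- `v i` is the value of variable `5 + 2 * i`, and `u i` that of `6 + 2 * i`
      let ρ (x : ℕ) : ℕ := if x < 5 ∨ 5 + 2 * t ≤ x then 0 else
        if x % 2 = 0 then u ((x - 6) / 2) else v ((x - 5) / 2)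
      refine ⟨ρ, fun x hx hx' => ?_, fun x hx => ?_, I, ?_, hcut⟩
      · simp only [ρ]
        split_ifs <;> simp [hn]
      · simp only [ρ, if_pos hx, henv]
      · convert hI using 2 with x
        refine RAM.forbidden_val (RAM.edge_input G) (fun i hi => ?_) (fun i hi => ?_) x
        · simp only [ρ]
          rw [if_neg (by lia), if_pos (by lia), show (6 + 2 * i - 6) / 2 = i by lia]
        · simp only [ρ]
          rw [if_neg (by lia), if_neg (by lia), show (5 + 2 * i - 5) / 2 = i by lia]
  have hrun := (RAM.forPairs t (RAM.testStmt t)).run_compile 0 n (RAM.input G)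
    (by simp [RAM.input]) (fun x => by simp [henv])
  obtain ⟨s, k, he, hk, hs⟩ : RAM.Run (.seq ((RAM.forPairs t (RAM.testStmt t)).compile 0)
      (.seq (.load 0 3 (RAM.varReg 0)) (.branch 0 (.const 0 1) (.const 0 0)))) (RAM.input G)
      ((RAM.forPairs t (RAM.testStmt t)).cost.eval n + (1 + (1 + 1)))
      fun s => (HasIndependentCutset G → s.reg 0 = 1) ∧
        (¬ HasIndependentCutset G → s.reg 0 = 0) := by
    refine RAM.Run.seq (hrun.mono le_rfl ?_)
    rintro s ⟨hs, hr⟩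
    have h2 : s.reg (RAM.varReg 0) = 0 := by rw [hr _ (by simp)]; simp [RAM.input]
    rw [← hs] at hans
    refine RAM.Run.seq (RAM.Run.load (RAM.Run.branch (fun h => RAM.Run.const ?_)
      (fun h => RAM.Run.const ?_)))
    · rw [RAM.State.reg_setReg, if_pos rfl, h2] at h
      simp [hans.1 h]
    · rw [RAM.State.reg_setReg, if_pos rfl, h2] at h
      simpa using fun h' => hans.2 h' h
  exact ⟨s, k, he, by simpa using hk, hs⟩
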